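/- Let $n\in\mathbb N$, let $\Sigma\in\mathbb R^{n\times n}$ be symmetric positive definite, let $\lambda\ge 0$, $\mu\in\mathbb R^n$, $\rho\in\mathbb R$, and let $\mathbf 1\in\mathbb R^n$ be the vector of ones. Consider the problem $$\min_{u\in\mathbb R^n}\ \tfrac12u^\top\Sigma u+\lambda\|u\|_1\quad\text{subject to}\quad \mu^\top u=\rho,\quad \mathbf 1^\top u=1,$$ with Lagrangian $L(u,p)=\tfrac12u^\top\Sigma u+\lambda\|u\|_1+p_1(\mathbf 1^\top u-1)+p_2(\mu^\top u-\rho)$ and KKT mapping $H:\mathbb R^n\times\mathbb R^2\rightrightarrows\mathbb R^n\times\mathbb R^2$, $$H(u,p)=\begin{pmatrix}\Sigma u+\lambda\,\partial\|u\|_1+p_1\mathbf 1+p_2\mu\\ \mu^\top u-\rho\\ \mathbf 1^\top u-1\end{pmatrix},$$ where $\partial\|u\|_1$ is the convex subdifferential of $\|\cdot\|_1$ at $u$. Let $u^*$ be an optimal solution and suppose that there are indices $i,j$ with $u_i^*\ne0$, $u_j^*\ne0$ and $\mu_i\ne\mu_j$. Then the Lagrange multiplier exists and is unique: there is $p^*\in\mathbb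 R^2$ such that, for every $p\in\mathbb R^2$, the pair $(u^*,p)$ is a saddle point of $L$ (that is, $L(u^*,q)\le L(u^*,p)\le L(u,p)$ for all $u\in\mathbb R^n$, $q\in\mathbb R^2$) if and only if $p=p^*$, and $0\in H(u^*,p)$ if and only if $p=p^*$. Moreover, with $w^*=(u^*,p^*)$, the mapping $H$ is globally strongly metrically subregular at $w^*$ for $0$: $0\in H(w^*)$ and there is a constant $c>0$ such that $$\|w-w^*\|\le c\,\operatorname{dist}(0,H(w))\quad\text{for all } w\in\mathbb R^n\times\mathbb R^2,$$ where norms and distances are Euclidean. -/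

import Mathlib

open scoped Matrix ENNReal

noncomputable section

/-- The set-valued mapping `H : X ⇉ Y` is globally strongly metrically subregular at `xbar` for
`ybar`: `ybar ∈ H xbar` and `dist (x, xbar) ≤ c * dist (ybar, H x)` for all `x`, for some `c > 0`.
Distances are extended, so that the distance to the empty set is infinite. -/
def GloballyStronglyMetricallySubregular {X Y : Type*} [MetricSpace X] [MetricSpace Y]
    (H : X → Set Y) (xbar : X) (ybar : Y) : Prop :=
  ybar ∈ H xbar ∧
    ∃ c : ℝ, 0 < c ∧ ∀ x : X, edist x xbar ≤ ENNReal.ofReal c * Metric.infEDist ybar (H x)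

/-- The convex subdifferential of `f` at `u`. -/
def convexSubdifferential {E : Type*} [NormedAddCommGroup E] [InnerProductSpace ℝ E]
    (f : E → ℝ) (u : E) : Set E :=
  {ξ | ∀ v : E, f u + inner ℝ ξ (v - u) ≤ f v}

namespace MLP

/-- Primal-dual pairs `w = (u, p)` in `ℝⁿ × ℝ²`, with the Euclidean norm of the product. -/
abbrev PrimalDual (n : ℕ) : Type :=
  WithLp 2 (EuclideanSpace ℝ (Fin n) × EuclideanSpace ℝ (Fin 2))

variable {n : ℕ}

/-- The pair `w = (u, p)`. -/
def pair (u : EuclideanSpace ℝ (Fin n)) (p : EuclideanSpace ℝ (Fin 2)) : PrimalDual n :=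
  WithLp.toLp 2 (u, p)

/-- The norm `‖u‖₁`. -/
def l1norm (u : EuclideanSpace ℝ (Fin n)) : ℝ := ∑ i, |u i|

/-- The vector of ones. -/
def ones (n : ℕ) : EuclideanSpace ℝ (Fin n) := WithLp.toLp 2 (fun _ => 1)

/-- The matrix-vector product `S u`. -/
def mulVec (S : Matrix (Fin n) (Fin n) ℝ) (u : EuclideanSpace ℝ (Fin n)) :
    EuclideanSpace ℝ (Fin n) :=
  WithLp.toLp 2 (S *ᵥ WithLp.ofLp u)

/-- The objective `½ uᵀ S u + lam ‖u‖₁`. -/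
def objective (S : Matrix (Fin n) (Fin n) ℝ) (lam : ℝ) (u : EuclideanSpace ℝ (Fin n)) : ℝ :=
  1 / 2 * inner ℝ u (mulVec S u) + lam * l1norm u

/-- The feasible set `{u | μᵀ u = ρ, 1ᵀ u = 1}`. -/
def feasible (μ : EuclideanSpace ℝ (Fin n)) (ρ : ℝ) : Set (EuclideanSpace ℝ (Fin n)) :=
  {u | inner ℝ μ u = ρ ∧ inner ℝ (ones n) u = 1}

/-- `u` is an optimal solution of the portfolio problem. -/
def IsOptimal (S : Matrix (Fin n) (Fin n) ℝ) (lam : ℝ) (μ : EuclideanSpace ℝ (Fin n)) (ρ : ℝ)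
    (u : EuclideanSpace ℝ (Fin n)) : Prop :=
  u ∈ feasible μ ρ ∧ ∀ v ∈ feasible μ ρ, objective S lam u ≤ objective S lam v

/-- The Lagrangian; the multiplier `p 0` belongs to the constraint `1ᵀ u = 1`
and `p 1` to the constraint `μᵀ u = ρ`. -/
def lagrangian (S : Matrix (Fin n) (Fin n) ℝ) (lam : ℝ) (μ : EuclideanSpace ℝ (Fin n)) (ρ : ℝ)
    (u : EuclideanSpace ℝ (Fin n)) (p : EuclideanSpace ℝ (Fin 2)) : ℝ :=
  objective S lam u + p 0 * (inner ℝ (ones n) u - 1) + p 1 * (inner ℝ μ u - ρ)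

/-- `(u, p)` is a saddle point of the Lagrangian. -/
def IsSaddlePoint (S : Matrix (Fin n) (Fin n) ℝ) (lam : ℝ) (μ : EuclideanSpace ℝ (Fin n)) (ρ : ℝ)
    (u : EuclideanSpace ℝ (Fin n)) (p : EuclideanSpace ℝ (Fin 2)) : Prop :=
  (∀ q, lagrangian S lam μ ρ u q ≤ lagrangian S lam μ ρ u p) ∧
    ∀ v, lagrangian S lam μ ρ u p ≤ lagrangian S lam μ ρ v p

/-- The KKT mapping
`H (u, p) = (S u + lam ∂‖u‖₁ + p₁ 1 + p₂ μ, μᵀ u - ρ, 1ᵀ u - 1)`. -/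
def kktMap (S : Matrix (Fin n) (Fin n) ℝ) (lam : ℝ) (μ : EuclideanSpace ℝ (Fin n)) (ρ : ℝ)
    (w : PrimalDual n) : Set (PrimalDual n) :=
  {y | ∃ ξ ∈ convexSubdifferential l1norm w.fst,
    y = pair (mulVec S w.fst + lam • ξ + w.snd 0 • ones n + w.snd 1 • μ)
      !₂[inner ℝ μ w.fst - ρ, inner ℝ (ones n) w.fst - 1]}

end MLP

end

namespace MLP

section

variable {n : ℕ}

/-! Existence of a multiplier is a separation argument. The set `S u* + lam ∂‖u*‖₁` is compact and
convex; if it missed the span of `1` and `μ`, a separating functional would give a feasible descent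
direction (`exists_subgradient_mem`).

Subregularity combines two estimates for `y ∈ H (v, q)`, with `d = ‖v - u*‖`. At coordinates `i`,
`j` with `u*` nonzero, subgradients of `|·|` are Lipschitz relative to the base point, so two rows
of the stationarity equation, independent as `μ i ≠ μ j`, give `‖q - p*‖ ≤ C (‖y‖ + d)`. Strong
monotonicity of the primal part gives `m d² ≤ ‖y‖ d + ‖q - p*‖ ‖y‖`, since the multiplier term pairs
`q - p*` only with the constraint residuals. Together they yield `d ≤ K ‖y‖`, then the bound on `q -
p*`. Uniqueness of the multiplier is the case `y = 0`. -/

theorem inner_eq_sum (x y : EuclideanSpace ℝ (Fin n)) : inner ℝ x y = ∑ k, x k * y k := by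
  simp [PiLp.inner_apply, mul_comm]

/-- Coordinatewise description of the subgradients of the norm `‖·‖₁`. -/
theorem mem_convexSubdifferential_l1norm {u ξ : EuclideanSpace ℝ (Fin n)} :
    ξ ∈ convexSubdifferential l1norm u ↔ ∀ k, |ξ k| ≤ 1 ∧ ξ k * u k = |u k| := by
  constructor
  · intro h k
    have key : ∀ s : ℝ, |u k| + ξ k * (s - u k) ≤ |s| := by
      intro s
      have h1 := h (u + EuclideanSpace.single k (s - u k))
      have h2 : l1norm (u + EuclideanSpace.single k (s - u k)) - l1norm u = |s| - |u k| := by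
        unfold l1norm
        rw [← Finset.sum_sub_distrib, Finset.sum_eq_single k]
        · simp
        · intro b _ hb
          simp [hb]
        · simp
      rw [add_sub_cancel_left, EuclideanSpace.inner_single_right] at h1
      simp at h1
      linarith
    -- The points `0` and `2 * u k` give the two halves of `ξ k * u k = |u k|`; the points `u k ± 1`
    -- give `|ξ k| ≤ 1`.
    have h0 := key 0
    have h1 := key (2 * u k)
    have h2 := key (u k + 1)
    have h3 := key (u k - 1)
    have h4 := abs_add_le (u k) 1
    have h5 := abs_sub (u k) 1
    rw [abs_mul] at h1
    simp only [abs_zero, abs_one, abs_two] at *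
    refine ⟨abs_le.2 ⟨by linarith, by linarith⟩, by linarith⟩
  · intro h v
    simp only [l1norm, inner_eq_sum, ← Finset.sum_add_distrib]
    refine Finset.sum_le_sum fun k _ => ?_
    have h1 : ξ k * v k ≤ |v k| :=
      (le_abs_self _).trans (by rw [abs_mul]; exact mul_le_of_le_one_left (abs_nonneg _) (h k).1)
    have h2 := (h k).2
    simp only [PiLp.sub_apply]
    linarith

theorem convex_convexSubdifferential_l1norm (u : EuclideanSpace ℝ (Fin n)) :
    Convex ℝ (convexSubdifferential l1norm u) := by
  intro x hx y hy a b ha hb hab v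
  rw [inner_add_left, inner_smul_left, inner_smul_left]
  have h1 := mul_le_mul_of_nonneg_left (hx v) ha
  have h2 := mul_le_mul_of_nonneg_left (hy v) hb
  have h3 : a = 1 - b := by linarith
  subst h3
  simp only [conj_trivial]
  linarith

theorem isCompact_convexSubdifferential_l1norm (u : EuclideanSpace ℝ (Fin n)) :
    IsCompact (convexSubdifferential l1norm u) := by
  refine Metric.isCompact_of_isClosed_isBounded ?_ ?_
  · simp only [convexSubdifferential, Set.ofPred_forall]
    exact isClosed_iInter fun v => isClosed_le (by fun_prop) continuous_const
  · refine (Metric.isBounded_closedBall (x := 0) (r := Real.sqrt n)).subset fun ξ hξ => ?_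
    rw [mem_closedBall_zero_iff, EuclideanSpace.norm_eq]
    refine Real.sqrt_le_sqrt ?_
    calc ∑ k, ‖ξ k‖ ^ 2 ≤ ∑ _k : Fin n, (1 : ℝ) := Finset.sum_le_sum fun k _ =>
          pow_le_one₀ (norm_nonneg _) (mem_convexSubdifferential_l1norm.1 hξ k).1
      _ = n := by simp

/-! ### The quadratic form -/

theorem mulVec_eq_toEuclideanLin (S : Matrix (Fin n) (Fin n) ℝ)
    (u : EuclideanSpace ℝ (Fin n)) : mulVec S u = Matrix.toEuclideanLin S u := rfl

theorem mulVec_add (S : Matrix (Fin n) (Fin n) ℝ) (u v : EuclideanSpace ℝ (Fin n)) :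
    mulVec S (u + v) = mulVec S u + mulVec S v := by
  simp [mulVec_eq_toEuclideanLin]

theorem mulVec_sub (S : Matrix (Fin n) (Fin n) ℝ) (u v : EuclideanSpace ℝ (Fin n)) :
    mulVec S (u - v) = mulVec S u - mulVec S v := by
  simp [mulVec_eq_toEuclideanLin]

theorem mulVec_smul (S : Matrix (Fin n) (Fin n) ℝ) (t : ℝ) (v : EuclideanSpace ℝ (Fin n)) :
    mulVec S (t • v) = t • mulVec S v := by
  simp [mulVec_eq_toEuclideanLin]

theorem inner_mulVec_comm {S : Matrix (Fin n) (Fin n) ℝ} (hS : S.IsHermitian)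
    (u v : EuclideanSpace ℝ (Fin n)) : inner ℝ (mulVec S u) v = inner ℝ u (mulVec S v) :=
  Matrix.isSymmetric_toEuclideanLin_iff.2 hS u v

theorem inner_mulVec_pos {S : Matrix (Fin n) (Fin n) ℝ} (hS : S.PosDef)
    {u : EuclideanSpace ℝ (Fin n)} (hu : u ≠ 0) : 0 < inner ℝ u (mulVec S u) := by
  have h := hS.dotProduct_mulVec_pos (x := WithLp.ofLp u) (by simpa using hu)
  rw [inner_eq_sum]
  simpa [dotProduct, mulVec] using h

theorem inner_mulVec_nonneg {S : Matrix (Fin n) (Fin n) ℝ} (hS : S.PosDef)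
    (u : EuclideanSpace ℝ (Fin n)) : 0 ≤ inner ℝ u (mulVec S u) := by
  rcases eq_or_ne u 0 with rfl | hu
  · simp
  · exact (inner_mulVec_pos hS hu).le

theorem exists_norm_mulVec_le (S : Matrix (Fin n) (Fin n) ℝ) :
    ∃ M : ℝ, 0 ≤ M ∧ ∀ u, ‖mulVec S u‖ ≤ M * ‖u‖ :=
  ⟨_, norm_nonneg _, (Matrix.toEuclideanLin S).toContinuousLinearMap.le_opNorm⟩

theorem exists_le_inner_mulVec {S : Matrix (Fin n) (Fin n) ℝ} (hS : S.PosDef) :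
    ∃ m : ℝ, 0 < m ∧ ∀ u, m * ‖u‖ ^ 2 ≤ inner ℝ u (mulVec S u) := by
  rcases (Metric.sphere (0 : EuclideanSpace ℝ (Fin n)) 1).eq_empty_or_nonempty with he | hne
  -- The unit sphere is empty only in dimension zero, where any constant works.
  · refine ⟨1, one_pos, fun u => ?_⟩
    have hu : u = 0 := by
      by_contra hu
      have : ‖u‖⁻¹ • u ∈ Metric.sphere (0 : EuclideanSpace ℝ (Fin n)) 1 := by
        simp [norm_smul, norm_ne_zero_iff.2 hu]
      simp [he] at this
    simp [hu]
  · have hc : Continuous fun u : EuclideanSpace ℝ (Fin n) => inner ℝ u (mulVec S u) :=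
      continuous_id.inner (Matrix.toEuclideanLin S).continuous_of_finiteDimensional
    obtain ⟨x, hx, hmin⟩ := (isCompact_sphere _ _).exists_isMinOn hne hc.continuousOn
    refine ⟨_, inner_mulVec_pos hS (ne_zero_of_mem_unit_sphere ⟨x, hx⟩), fun u => ?_⟩
    rcases eq_or_ne u 0 with rfl | hu
    · simp
    have hu' : ‖u‖ ≠ 0 := norm_ne_zero_iff.2 hu
    have h : ‖u‖⁻¹ • u ∈ Metric.sphere (0 : EuclideanSpace ℝ (Fin n)) 1 := by
      simp [norm_smul, hu']
    have h1 := hmin h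
    simp only [Set.mem_ofPred_eq, mulVec_smul, inner_smul_left, inner_smul_right,
      conj_trivial] at h1
    calc _ ≤ (‖u‖⁻¹ * (‖u‖⁻¹ * inner ℝ u (mulVec S u))) * ‖u‖ ^ 2 := by gcongr
      _ = _ := by field_simp

/-! ### Optimality conditions and existence of multipliers -/

theorem objective_add {S : Matrix (Fin n) (Fin n) ℝ} (hS : S.IsHermitian) (lam : ℝ)
    (u v : EuclideanSpace ℝ (Fin n)) :
    objective S lam (u + v) = objective S lam u + inner ℝ (mulVec S u) v
      + 1 / 2 * inner ℝ v (mulVec S v) + lam * (l1norm (u + v) - l1norm u) := by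
  have h1 := inner_mulVec_comm hS u v
  have h2 := real_inner_comm v (mulVec S u)
  simp only [objective, mulVec_add, inner_add_left, inner_add_right]
  linarith

/-- The directional derivative of `‖·‖₁` is attained at a subgradient. -/
theorem exists_subgradient_l1norm_add_smul (u d : EuclideanSpace ℝ (Fin n)) :
    ∃ ξ ∈ convexSubdifferential l1norm u,
      ∀ᶠ t in nhdsWithin (0 : ℝ) (Set.Ioi 0), l1norm (u + t • d) = l1norm u + t * inner ℝ ξ d := by
  have hcoord : ∀ a b : ℝ, ∃ x : ℝ, (|x| ≤ 1 ∧ x * a = |a|) ∧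
      ∀ᶠ t in nhdsWithin (0 : ℝ) (Set.Ioi 0), |a + t * b| = |a| + t * (x * b) := by
    intro a b
    have hlim : Filter.Tendsto (fun t : ℝ => a + t * b) (nhdsWithin 0 (Set.Ioi 0)) (nhds a) := by
      have : Filter.Tendsto (fun t : ℝ => a + t * b) (nhds 0) (nhds (a + 0 * b)) :=
        Continuous.tendsto (by fun_prop) 0
      simpa using this.mono_left nhdsWithin_le_nhds
    rcases lt_trichotomy a 0 with ha | rfl | ha
    · refine ⟨-1, ⟨by simp, by simp [abs_of_neg ha]⟩, ?_⟩
      filter_upwards [hlim.eventually (gt_mem_nhds ha)] with t ht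
      rw [abs_of_neg ht, abs_of_neg ha]
      ring
    · refine ⟨SignType.sign b, ⟨?_, by simp⟩, ?_⟩
      · rcases lt_trichotomy b 0 with hb | rfl | hb <;> simp [*]
      · filter_upwards [self_mem_nhdsWithin] with t ht
        rw [sign_mul_self, zero_add, abs_mul, abs_of_pos ht, abs_zero, zero_add]
    · refine ⟨1, ⟨by simp, by simp [abs_of_pos ha]⟩, ?_⟩
      filter_upwards [hlim.eventually (lt_mem_nhds ha)] with t ht
      rw [abs_of_pos ht, abs_of_pos ha]
      ring
  choose x hx hlim using fun k => hcoord (u k) (d k)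
  refine ⟨WithLp.toLp 2 x, mem_convexSubdifferential_l1norm.2 hx, ?_⟩
  filter_upwards [Filter.eventually_all.2 hlim] with t ht
  simp [l1norm, inner_eq_sum, ht, Finset.sum_add_distrib, Finset.mul_sum]

/-- One-sided difference quotients at a minimum along a line are nonnegative. The subgradient
depends on `d`; finding one that serves all directions requires separation. -/
theorem exists_subgradient_inner_nonneg {S : Matrix (Fin n) (Fin n) ℝ} (hS : S.IsHermitian)
    (lam : ℝ) {g u d : EuclideanSpace ℝ (Fin n)}
    (hmin : ∀ t : ℝ, objective S lam u + inner ℝ g u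
      ≤ objective S lam (u + t • d) + inner ℝ g (u + t • d)) :
    ∃ ξ ∈ convexSubdifferential l1norm u, 0 ≤ inner ℝ (mulVec S u + g + lam • ξ) d := by
  obtain ⟨ξ, hξ, hev⟩ := exists_subgradient_l1norm_add_smul u d
  refine ⟨ξ, hξ, ?_⟩
  have hlim : Filter.Tendsto
      (fun t : ℝ => inner ℝ (mulVec S u + g + lam • ξ) d + t * (1 / 2 * inner ℝ d (mulVec S d)))
      (nhdsWithin 0 (Set.Ioi 0)) (nhds (inner ℝ (mulVec S u + g + lam • ξ) d)) := by
    have : Filter.Tendsto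
        (fun t : ℝ => inner ℝ (mulVec S u + g + lam • ξ) d + t * (1 / 2 * inner ℝ d (mulVec S d)))
        (nhds 0) (nhds (inner ℝ (mulVec S u + g + lam • ξ) d
          + 0 * (1 / 2 * inner ℝ d (mulVec S d)))) :=
      Continuous.tendsto (by fun_prop) 0
    simpa using this.mono_left nhdsWithin_le_nhds
  refine ge_of_tendsto hlim ?_
  filter_upwards [hev, self_mem_nhdsWithin] with t ht htpos
  have h := hmin t
  rw [objective_add hS, ht] at h
  simp only [mulVec_smul, inner_add_right, inner_smul_left, inner_smul_right,
    conj_trivial] at h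
  simp only [inner_add_left, inner_smul_left, conj_trivial]
  refine nonneg_of_mul_nonneg_right ?_ (Set.mem_Ioi.1 htpos)
  linarith

/-- Separation of the compact convex set `S u + g + lam ∂‖u‖₁` from a subspace. -/
theorem exists_subgradient_mem {S : Matrix (Fin n) (Fin n) ℝ} (hS : S.IsHermitian)
    (lam : ℝ) {g u : EuclideanSpace ℝ (Fin n)} (R : Submodule ℝ (EuclideanSpace ℝ (Fin n)))
    (hmin : ∀ d ∈ Rᗮ, objective S lam u + inner ℝ g u
      ≤ objective S lam (u + d) + inner ℝ g (u + d)) :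
    ∃ ξ ∈ convexSubdifferential l1norm u, mulVec S u + g + lam • ξ ∈ R := by
  by_contra! hcon
  have hdisj : Disjoint ((fun ξ => mulVec S u + g + lam • ξ) '' convexSubdifferential l1norm u)
      (R : Set (EuclideanSpace ℝ (Fin n))) := by
    rw [Set.disjoint_left]
    rintro _ ⟨ξ, hξ, rfl⟩
    exact hcon ξ hξ
  have hconv : Convex ℝ
      ((fun ξ => mulVec S u + g + lam • ξ) '' convexSubdifferential l1norm u) := by
    have := ((convex_convexSubdifferential_l1norm u).smul lam).translate (mulVec S u + g)
    rwa [← Set.image_smul, Set.image_image] at this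
  obtain ⟨f, a, b, hfa, hab, hfb⟩ := geometric_hahn_banach_compact_closed hconv
    ((isCompact_convexSubdifferential_l1norm u).image (by fun_prop)) R.convex
    R.closed_of_finiteDimensional hdisj
  have hb : b < 0 := by simpa using hfb 0 R.zero_mem
  -- A functional bounded below on a subspace vanishes there: otherwise some multiple of `r` would
  -- attain the excluded value `b`.
  have hf : ∀ r ∈ R, f r = 0 := by
    intro r hr
    by_contra hne
    have := hfb ((b / f r) • r) (R.smul_mem _ hr)
    rw [map_smul, smul_eq_mul, div_mul_cancel₀ _ hne] at this
    exact lt_irrefl _ this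
  set d := (InnerProductSpace.toDual ℝ (EuclideanSpace ℝ (Fin n))).symm f
  have hd : ∀ x, inner ℝ d x = f x := fun x => InnerProductSpace.toDual_symm_apply
  have hdR : d ∈ Rᗮ := (Submodule.mem_orthogonal' _ _).2 fun r hr => by rw [hd, hf r hr]
  obtain ⟨ξ, hξ, hnn⟩ := exists_subgradient_inner_nonneg hS lam
    fun t => hmin (t • d) (Rᗮ.smul_mem t hdR)
  -- On the image `f < a < b < 0`, which contradicts nonnegativity along `d`.
  rw [real_inner_comm, hd] at hnn
  have := hfa _ ⟨ξ, hξ, rfl⟩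
  linarith

theorem zero_mem_kktMap_iff (S : Matrix (Fin n) (Fin n) ℝ) (lam : ℝ)
    (μ : EuclideanSpace ℝ (Fin n)) (ρ : ℝ) {u : EuclideanSpace ℝ (Fin n)}
    (hu : u ∈ feasible μ ρ) (p : EuclideanSpace ℝ (Fin 2)) :
    0 ∈ kktMap S lam μ ρ (pair u p) ↔ ∃ ξ ∈ convexSubdifferential l1norm u,
      mulVec S u + lam • ξ + p 0 • ones n + p 1 • μ = 0 := by
  have h0 : !₂[inner ℝ μ u - ρ, inner ℝ (ones n) u - 1] = (0 : EuclideanSpace ℝ (Fin 2)) := by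
    ext k
    fin_cases k <;> simp [hu.1, hu.2]
  have hp : ∀ x : EuclideanSpace ℝ (Fin n), (0 : PrimalDual n) = pair x 0 ↔ x = 0 := by
    intro x
    rw [eq_comm]
    simp [pair]
  change (∃ ξ ∈ convexSubdifferential l1norm u, (0 : PrimalDual n) =
    pair (mulVec S u + lam • ξ + p 0 • ones n + p 1 • μ)
      !₂[inner ℝ μ u - ρ, inner ℝ (ones n) u - 1]) ↔ _
  simp only [h0, hp]

theorem isSaddlePoint_iff {S : Matrix (Fin n) (Fin n) ℝ} (hS : S.PosDef) {lam : ℝ}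
    (hlam : 0 ≤ lam) (μ : EuclideanSpace ℝ (Fin n)) (ρ : ℝ) {u : EuclideanSpace ℝ (Fin n)}
    (hu : u ∈ feasible μ ρ) (p : EuclideanSpace ℝ (Fin 2)) :
    IsSaddlePoint S lam μ ρ u p ↔ 0 ∈ kktMap S lam μ ρ (pair u p) := by
  have hlag : ∀ v, lagrangian S lam μ ρ v p =
      objective S lam v + inner ℝ (p 0 • ones n + p 1 • μ) v - (p 0 + p 1 * ρ) := by
    intro v
    simp only [lagrangian, inner_add_left, inner_smul_left, conj_trivial]
    ring
  rw [zero_mem_kktMap_iff S lam μ ρ hu]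
  constructor
  · rintro ⟨-, h⟩
    -- With `R = ⊥` every direction is admissible, and separation becomes Fermat's rule for the
    -- Lagrangian.
    obtain ⟨ξ, hξ, h0⟩ := exists_subgradient_mem hS.isHermitian lam
      (g := p 0 • ones n + p 1 • μ) (u := u) ⊥ fun d _ => by
        have := h (u + d)
        rw [hlag, hlag] at this
        linarith
    refine ⟨ξ, hξ, ?_⟩
    rw [← (Submodule.mem_bot ℝ).1 h0]
    abel
  · rintro ⟨ξ, hξ, h0⟩
    refine ⟨fun q => by simp [lagrangian, hu.1, hu.2], fun v => ?_⟩
    have h1 := objective_add hS.isHermitian lam u (v - u)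
    have h2 := inner_mulVec_nonneg hS (v - u)
    have h3 := mul_le_mul_of_nonneg_left (hξ v) hlam
    have h4 : inner ℝ (mulVec S u + lam • ξ + p 0 • ones n + p 1 • μ) (v - u) = 0 := by
      rw [h0, inner_zero_left]
    rw [hlag, hlag]
    rw [add_sub_cancel] at h1
    simp only [inner_add_left, inner_sub_right, inner_smul_left, conj_trivial] at *
    linarith

theorem exists_zero_mem_kktMap {S : Matrix (Fin n) (Fin n) ℝ} (hS : S.PosDef) (lam : ℝ)
    {μ : EuclideanSpace ℝ (Fin n)} {ρ : ℝ} {u : EuclideanSpace ℝ (Fin n)}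
    (hopt : IsOptimal S lam μ ρ u) : ∃ p, 0 ∈ kktMap S lam μ ρ (pair u p) := by
  -- The orthogonal complement of this span consists of the directions that preserve both
  -- constraints.
  obtain ⟨ξ, hξ, h⟩ := exists_subgradient_mem hS.isHermitian lam (g := 0) (u := u)
    (Submodule.span ℝ {ones n, μ}) fun d hd => by
      rw [Submodule.mem_orthogonal] at hd
      have h1 := hd (ones n) (Submodule.subset_span (by simp))
      have h2 := hd μ (Submodule.subset_span (by simp))
      simpa using hopt.2 (u + d)
        ⟨by rw [inner_add_right, h2, hopt.1.1, add_zero],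
          by rw [inner_add_right, h1, hopt.1.2, add_zero]⟩
  obtain ⟨a, b, hab⟩ := Submodule.mem_span_pair.1 h
  refine ⟨!₂[-a, -b], (zero_mem_kktMap_iff S lam μ ρ hopt.1 _).2 ⟨ξ, hξ, ?_⟩⟩
  rw [add_zero] at hab
  rw [← hab]
  simp only [Matrix.cons_val_zero, Matrix.cons_val_one]
  module

/-! ### Error estimates for the KKT mapping -/

/-- Subgradients of `|·|` at a nonzero point vary in a Lipschitz way, globally. -/
theorem abs_sub_subgradient_le {a b x y : ℝ} (ha : a ≠ 0) (hx : |x| ≤ 1) (hxa : x * a = |a|)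
    (hy : |y| ≤ 1) (hyb : y * b = |b|) : |y - x| ≤ 2 / |a| * |b - a| := by
  have hapos := abs_pos.2 ha
  rw [div_mul_eq_mul_div, le_div_iff₀ hapos]
  -- With equal signs both subgradients are that sign. Otherwise `b` is at least `|a|` away from
  -- `a`, while subgradients differ by at most 2.
  by_cases h : 0 < a * b
  · have hxy : y = x := by
      rcases pos_and_pos_or_neg_and_neg_of_mul_pos h with ⟨h1, h2⟩ | ⟨h1, h2⟩
      · rw [abs_of_pos h1] at hxa
        rw [abs_of_pos h2] at hyb
        rw [mul_eq_right₀ h1.ne'] at hxa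
        rw [mul_eq_right₀ h2.ne'] at hyb
        rw [hxa, hyb]
      · rw [abs_of_neg h1] at hxa
        rw [abs_of_neg h2] at hyb
        apply mul_right_cancel₀ (mul_ne_zero h1.ne h2.ne)
        linear_combination a * hyb - b * hxa
    simp [hxy]
  · have h1 : |a| ≤ |b - a| := by
      apply sq_le_sq.1
      nlinarith [sq_nonneg b]
    have h2 : |y - x| ≤ 2 := (abs_sub y x).trans (by linarith)
    gcongr

/-- An affine function on the line is determined by its values at two points; applied with `s = μ
i`, `t = μ j`. -/
theorem exists_norm_le_of_line_values {s t : ℝ} (h : s ≠ t) :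
    ∃ C : ℝ, 0 ≤ C ∧ ∀ q : EuclideanSpace ℝ (Fin 2),
      ‖q‖ ≤ C * (|q 0 + q 1 * s| + |q 0 + q 1 * t|) := by
  have hst : 0 < |s - t| := abs_pos.2 (sub_ne_zero.2 h)
  refine ⟨(1 + |s|) / |s - t| + 1, by positivity, fun q => ?_⟩
  have h1 : |q 1| = |(q 0 + q 1 * s) - (q 0 + q 1 * t)| / |s - t| := by
    rw [← abs_div]
    congr 1
    field_simp [sub_ne_zero.2 h]
    ring
  have h2 : |q 1| ≤ (|q 0 + q 1 * s| + |q 0 + q 1 * t|) / |s - t| := by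
    rw [h1]
    gcongr
    exact abs_sub _ _
  have h3 : |q 0| ≤ |q 0 + q 1 * s| + |q 1| * |s| := by
    rw [← abs_mul]
    simpa using abs_sub (q 0 + q 1 * s) (q 1 * s)
  have h4 : ‖q‖ ≤ |q 0| + |q 1| := by
    rw [EuclideanSpace.norm_eq, Fin.sum_univ_two]
    apply Real.sqrt_le_iff.2 ⟨by positivity, ?_⟩
    simp only [Real.norm_eq_abs]
    nlinarith [mul_nonneg (abs_nonneg (q 0)) (abs_nonneg (q 1))]
  calc ‖q‖ ≤ (1 + |s|) * |q 1| + |q 0 + q 1 * s| := by linarith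
    _ ≤ (1 + |s|) * ((|q 0 + q 1 * s| + |q 0 + q 1 * t|) / |s - t|)
        + (|q 0 + q 1 * s| + |q 0 + q 1 * t|) := by
      gcongr
      exact le_add_of_nonneg_right (abs_nonneg _)
    _ = _ := by ring

theorem le_mul_of_quadratic_le {m C d y : ℝ} (hm : 0 < m) (hC : 0 ≤ C) (hy : 0 ≤ y)
    (h : m * d ^ 2 ≤ y * d + C * (y + d) * y) : d ≤ ((1 + 2 * C) / m + 1) * y := by
  -- The summand 1 in the constant forces `y ≤ d` here, so `y * y` can be replaced by `y * d` and a
  -- factor `d` cancelled.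
  by_contra! hlt
  have hK : 0 ≤ (1 + 2 * C) / m * y := by positivity
  have hyd : y ≤ d := by linarith
  have hdpos : 0 < d := by linarith
  have h1 : C * y * y ≤ C * y * d := by gcongr
  have h2 : m * d ≤ (1 + 2 * C) * y := by
    refine le_of_mul_le_mul_right ?_ hdpos
    linarith
  have h3 : d ≤ (1 + 2 * C) / m * y := by
    rw [div_mul_eq_mul_div, le_div_iff₀ hm]
    linarith
  linarith

theorem exists_norm_sub_le {S : Matrix (Fin n) (Fin n) ℝ} (hS : S.PosDef) {lam : ℝ}
    (hlam : 0 ≤ lam) {μ : EuclideanSpace ℝ (Fin n)} {ρ : ℝ} {u : EuclideanSpace ℝ (Fin n)}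
    {p : EuclideanSpace ℝ (Fin 2)} (hu : u ∈ feasible μ ρ)
    (h0 : 0 ∈ kktMap S lam μ ρ (pair u p))
    (hnz : ∃ i j : Fin n, u i ≠ 0 ∧ u j ≠ 0 ∧ μ i ≠ μ j) :
    ∃ c : ℝ, 0 < c ∧ ∀ w, ∀ y ∈ kktMap S lam μ ρ w, ‖w - pair u p‖ ≤ c * ‖y‖ := by
  obtain ⟨ξ, hξ, hkkt⟩ := (zero_mem_kktMap_iff S lam μ ρ hu p).1 h0
  obtain ⟨i, j, hi, hj, hij⟩ := hnz
  obtain ⟨M, hM, hSM⟩ := exists_norm_mulVec_le S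
  obtain ⟨m, hm, hSm⟩ := exists_le_inner_mulVec hS
  obtain ⟨A, hA, hqA⟩ := exists_norm_le_of_line_values hij
  obtain ⟨B, hB, hBi, hBj⟩ : ∃ B : ℝ, 0 ≤ B ∧ 2 / |u i| ≤ B ∧ 2 / |u j| ≤ B :=
    ⟨max (2 / |u i|) (2 / |u j|), by positivity, le_max_left _ _, le_max_right _ _⟩
  -- The factor 2 comes from adding the row estimates at `i` and `j`.
  obtain ⟨C, hC⟩ : ∃ C, C = A * (2 * (1 + M + lam * B)) := ⟨_, rfl⟩
  have hC0 : 0 ≤ C := by rw [hC]; positivity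
  obtain ⟨K, hK⟩ : ∃ K, K = (1 + 2 * C) / m + 1 := ⟨_, rfl⟩
  have hK0 : 0 < K := by rw [hK]; positivity
  refine ⟨K + C * (1 + K), by positivity, ?_⟩
  rintro w y ⟨η, hη, rfl⟩
  set v := w.fst
  set q := w.snd
  set a := mulVec S v + lam • η + q 0 • ones n + q 1 • μ with ha
  set b : EuclideanSpace ℝ (Fin 2) := !₂[inner ℝ μ v - ρ, inner ℝ (ones n) v - 1] with hb
  have hay : ‖a‖ ≤ ‖pair a b‖ := WithLp.norm_fst_le _ (pair a b)
  have hby : ‖b‖ ≤ ‖pair a b‖ := WithLp.norm_snd_le _ (pair a b)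
  set Y := ‖pair a b‖
  have hY : 0 ≤ Y := norm_nonneg _
  have haeq : a = mulVec S (v - u) + lam • (η - ξ) + (q - p) 0 • ones n + (q - p) 1 • μ := by
    rw [← sub_zero a, ← hkkt, ha, mulVec_sub]
    simp only [PiLp.sub_apply]
    module
  have hcoord : ∀ k, u k ≠ 0 → 2 / |u k| ≤ B →
      |(q - p) 0 + (q - p) 1 * μ k| ≤ (1 + M + lam * B) * (Y + ‖v - u‖) := by
    intro k hk hkB
    have h1 : (q - p) 0 + (q - p) 1 * μ k = a k - mulVec S (v - u) k - lam * (η k - ξ k) := by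
      rw [haeq]
      simp [ones]
      ring
    obtain ⟨hx, hxa⟩ := mem_convexSubdifferential_l1norm.1 hξ k
    obtain ⟨hy, hya⟩ := mem_convexSubdifferential_l1norm.1 hη k
    have h2 := abs_sub_subgradient_le hk hx hxa hy hya
    have h3 : |v k - u k| ≤ ‖v - u‖ := PiLp.norm_apply_le (v - u) k
    have h4 : |a k| ≤ Y := (PiLp.norm_apply_le a k).trans hay
    have h5 : |mulVec S (v - u) k| ≤ M * ‖v - u‖ :=
      (PiLp.norm_apply_le (mulVec S (v - u)) k).trans (hSM _)
    have h6 : |η k - ξ k| ≤ B * ‖v - u‖ := h2.trans (by gcongr)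
    have h7 : |lam * (η k - ξ k)| ≤ lam * (B * ‖v - u‖) := by
      rw [abs_mul, abs_of_nonneg hlam]
      gcongr
    have h8 := abs_sub (a k - mulVec S (v - u) k) (lam * (η k - ξ k))
    have h9 := abs_sub (a k) (mulVec S (v - u) k)
    have h10 : 0 ≤ (M + lam * B) * Y := by positivity
    have h11 := norm_nonneg (v - u)
    rw [h1]
    linarith
  have hq : ‖q - p‖ ≤ C * (Y + ‖v - u‖) := by
    refine (hqA (q - p)).trans ?_
    rw [hC, mul_assoc]
    refine mul_le_mul_of_nonneg_left ?_ hA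
    linarith [hcoord i hi hBi, hcoord j hj hBj]
  have hmono : m * ‖v - u‖ ^ 2 ≤ Y * ‖v - u‖ + C * (Y + ‖v - u‖) * Y := by
    -- The entries of `b` are swapped because `H` lists the `μ`-residual first, whereas `p 0`
    -- belongs to the constraint on `1`.
    have h1 : inner ℝ a (v - u) = inner ℝ (v - u) (mulVec S (v - u))
        + lam * inner ℝ (η - ξ) (v - u) + inner ℝ (!₂[b 1, b 0] : EuclideanSpace ℝ (Fin 2)) (q - p) := by
      have h2 : inner ℝ (ones n) (v - u) = b 1 := by
        rw [inner_sub_right, hu.2]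
        simp [hb]
      have h3 : inner ℝ μ (v - u) = b 0 := by
        rw [inner_sub_right, hu.1]
        simp [hb]
      rw [haeq]
      simp only [inner_add_left, inner_smul_left, conj_trivial, h2, h3,
        real_inner_comm (v - u) (mulVec S (v - u))]
      rw [inner_eq_sum _ (q - p), Fin.sum_univ_two]
      simp
      ring
    have h2 : ‖(!₂[b 1, b 0] : EuclideanSpace ℝ (Fin 2))‖ = ‖b‖ := by
      simp [EuclideanSpace.norm_eq, Fin.sum_univ_two, add_comm]
    have h3 : 0 ≤ inner ℝ (η - ξ) (v - u) := by
      have e1 := hη u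
      have e2 := hξ v
      rw [← neg_sub v u, inner_neg_right] at e1
      rw [inner_sub_left]
      linarith
    have h4 := mul_nonneg hlam h3
    have h5 : inner ℝ a (v - u) ≤ Y * ‖v - u‖ := (real_inner_le_norm _ _).trans (by gcongr)
    have h6 : -(C * (Y + ‖v - u‖) * Y) ≤
        inner ℝ (!₂[b 1, b 0] : EuclideanSpace ℝ (Fin 2)) (q - p) := by
      refine (neg_le_neg ?_).trans (neg_le_of_abs_le (abs_real_inner_le_norm _ _))
      rw [h2, mul_comm]
      gcongr
    have h7 := hSm (v - u)
    linarith
  have hd := le_mul_of_quadratic_le hm hC0 hY hmono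
  rw [← hK] at hd
  have hw : ‖w - pair u p‖ ≤ ‖v - u‖ + ‖q - p‖ := by
    refine le_of_sq_le_sq ?_ (by positivity)
    rw [WithLp.prod_norm_sq_eq_of_L2]
    change ‖v - u‖ ^ 2 + ‖q - p‖ ^ 2 ≤ _
    nlinarith [mul_nonneg (norm_nonneg (v - u)) (norm_nonneg (q - p))]
  have hq' : ‖q - p‖ ≤ C * (Y + K * Y) := hq.trans (by gcongr)
  linarith

end

end MLP

/-- Dividing by `c` turns the claim into a lower bound on an infimum, to be checked element by
element; an empty value imposes nothing. -/
theorem globallyStronglyMetricallySubregular_of_norm_le {X Y : Type*} [NormedAddCommGroup X]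
    [NormedAddCommGroup Y] {H : X → Set Y} {x₀ : X} (h0 : 0 ∈ H x₀) {c : ℝ} (hc : 0 < c)
    (h : ∀ x, ∀ y ∈ H x, ‖x - x₀‖ ≤ c * ‖y‖) : GloballyStronglyMetricallySubregular H x₀ 0 := by
  refine ⟨h0, c, hc, fun x => ?_⟩
  have hc' : ENNReal.ofReal c ≠ 0 := (ENNReal.ofReal_pos.2 hc).ne'
  rw [mul_comm, ← ENNReal.div_le_iff hc' ENNReal.ofReal_ne_top, Metric.le_infEDist]
  intro y hy
  rw [ENNReal.div_le_iff hc' ENNReal.ofReal_ne_top, edist_dist, edist_dist, dist_zero_left,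
    ← ENNReal.ofReal_mul (norm_nonneg y), dist_eq_norm, mul_comm]
  exact ENNReal.ofReal_le_ofReal (h x y hy)

theorem proposition2 (n : ℕ) (S : Matrix (Fin n) (Fin n) ℝ) (hS : S.PosDef)
    (lam : ℝ) (hlam : 0 ≤ lam) (μ : EuclideanSpace ℝ (Fin n)) (ρ : ℝ)
    (ustar : EuclideanSpace ℝ (Fin n)) (hopt : MLP.IsOptimal S lam μ ρ ustar)
    (hnz : ∃ i j : Fin n, ustar i ≠ 0 ∧ ustar j ≠ 0 ∧ μ i ≠ μ j) :
    ∃ pstar : EuclideanSpace ℝ (Fin 2),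
      (∀ p, MLP.IsSaddlePoint S lam μ ρ ustar p ↔ p = pstar) ∧
      (∀ p, 0 ∈ MLP.kktMap S lam μ ρ (MLP.pair ustar p) ↔ p = pstar) ∧
      GloballyStronglyMetricallySubregular (MLP.kktMap S lam μ ρ) (MLP.pair ustar pstar) 0 := by
  obtain ⟨pstar, h0⟩ := MLP.exists_zero_mem_kktMap hS lam hopt
  obtain ⟨c, hc, hbound⟩ := MLP.exists_norm_sub_le hS hlam hopt.1 h0 hnz
  have huniq : ∀ p, 0 ∈ MLP.kktMap S lam μ ρ (MLP.pair ustar p) ↔ p = pstar := by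
    intro p
    refine ⟨fun hp => ?_, fun hp => hp ▸ h0⟩
    have h := hbound _ 0 hp
    rw [norm_zero, mul_zero, norm_le_zero_iff, sub_eq_zero] at h
    exact congrArg WithLp.snd h
  exact ⟨pstar, fun p => (MLP.isSaddlePoint_iff hS hlam μ ρ hopt.1 p).trans (huniq p), huniq,
    globallyStronglyMetricallySubregular_of_norm_le h0 hc hbound⟩
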